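/- For $b\in\mathbb C$ and integers $k\ge 2$ let $\zeta(k,b)=\sum_{j\ge 0}(j+b)^{-k}$, where, if $b$ is an integer $\le 0$, the one summand with $j+b=0$ is skipped. Put $c_k(b)=\zeta(k,b)-b^{-k}$ for $b\ne 0$ and $c_k(0)=\zeta(k)$. Let $b\in\mathbb C$ be such that either $2b\notin\mathbb Z$ or $b\in\mathbb Z$ (so only half-odd-integers are excluded), and define, for $2(x-b)\notin\mathbb Z$, $$F_b(x)=\begin{cases} \dfrac{x^2}{2b(x-b)}-\dfrac{\pi x\sin\pi x}{2\sin\pi b}\csc\pi(x-b)-\pi x\displaystyle\int_0^1\Big(\frac{\sin 2\pi(x-b)u}{\sin2\pi(x-b)}-\frac{\sin2\pi bu}{\sin 2\pi b}\Big)\cot\pi u\,du & 2b\notin\mathbb Z,\\[2mm] \dfrac12-\dfrac{\pi x}{2}\cot\pi x-\pi x\displaystyle\int_0^1\Big(\frac{\sin2\pi xu}{\sin2\pi x}-u\Big)\cot\pi u\,du & b=0,\\[2mm] \dfrac{x^2}{2b(x-b)}-\dfrac{\pi x}{2}\cot\pi x-\pi x\displaystyle\int_0^1\Big(\frac{\sin2\pi(x-b)u}{\sin2\pi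 x}-u\cos2\pi bu\Big)\cot\pi u\,du & b\in\{1,2,\dots\},\\[2mm] 1+\dfrac{x^2}{2b(x-b)}-\dfrac{\pi x}{2}\cot\pi x-\pi x\displaystyle\int_0^1\Big(\frac{\sin2\pi(x-b)u}{\sin2\pi x}-u\cos2\pi bu\Big)\cot\pi u\,du & b\in\{-1,-2,\dots\}. \end{cases}$$ Then: 1. For $k\ge2$, $c_k(b)=\sum_{j\ge1,\ j+b\ne0}(j+b)^{-k}$, the sum converging absolutely; if $b$ is a positive integer, $c_k(b)=\zeta(k)-\sum_{j=1}^{b}j^{-k}$. 2. Let $2(x-b)\notin\mathbb Z$. The integral defining $F_b(x)$ converges absolutely. If $|x|<|j+b|$ for every $j\ge1$ with $j+b\neq0$, then $\sum_{k\ge2}c_k(b)x^k$ converges absolutely with sum $F_b(x)$. Whenever this series converges (in the sense of partial sums), its sum is $F_b(x)$. 3. Set $f(x)=F_b(x)$ for $x\neq0$ and $f(0)=0$. The set $U_b=\{x\in\mathbb C:2(x-b)\notin\mathbb Z\}\cup\{0\}$ is open and connected and $f$ is analytic on it, so $f$ is an analytic continuation of the series. 4. For $k\ge 2$: $\zeta(k,b)=b^{-k}+f^{(k)}(0)/k!$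 if $b\ne0$, and $\zeta(k)=f^{(k)}(0)/k!$ if $b=0$. 5. (Hyperbolic form.) Let $b\in\mathbb C$ with $2ib\notin\mathbb Z$. For $k\ge2$ the sum $d_k(b)=\sum_{j\ge1}(ij+b)^{-k}$ converges absolutely. For $2i(x-b)\notin\mathbb Z$ put $$H_b(x)=\frac{x^2}{2b(x-b)}+\frac{\pi x(e^{2\pi x}-1)}{(e^{-2\pi b}-1)(e^{2\pi x}-e^{2\pi b})}+i\pi x\int_0^1\Big(\frac{\sinh2\pi(x-b)u}{\sinh2\pi(x-b)}-\frac{\sinh2\pi bu}{\sinh2\pi b}\Big)\cot\pi u\,du,$$ where the integral converges absolutely. If $|x|<|ij+b|$ for all $j\ge1$, then $\sum_{k\ge2}d_k(b)x^k$ converges absolutely with sum $H_b(x)$; whenever this series converges, its sum is $H_b(x)$; and $H_b$ is analytic on the open connected set $\{x\in\mathbb C:2i(x-b)\notin\mathbb Z\}$. -/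

import Mathlib

open Filter Topology

namespace HurwitzGen

/-- The set of rational integers inside `ℂ`. -/
def integers : Set ℂ := Set.range (fun n : ℤ => (n : ℂ))

/-- The summand `1 / (j + b)^k`; a summand with vanishing denominator is skipped
(this can happen only if `b` is an integer with `b ≤ 0`). -/
noncomputable def term (k j : ℕ) (b : ℂ) : ℂ :=
  open Classical in if (j : ℂ) + b = 0 then 0 else 1 / ((j : ℂ) + b) ^ k

/-- The Hurwitz zeta value `ζ(k, b) = ∑_{j ≥ 0} 1 / (j + b)^k`, skipping a singular summand. -/
noncomputable def hurwitz (k : ℕ) (b : ℂ) : ℂ := ∑' j : ℕ, term k j b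

/-- The coefficient `ζ(k, b) - 1 / b^k` of the generating function; for `b = 0` it is `ζ(k)`. -/
noncomputable def coeff (k : ℕ) (b : ℂ) : ℂ :=
  open Classical in if b = 0 then riemannZeta (k : ℂ) else hurwitz k b - 1 / b ^ k

/-- The integrand of the closed form when `2b` is not an integer. -/
noncomputable def genericIntegrand (b x : ℂ) (u : ℝ) : ℂ :=
  (Complex.sin (2 * Real.pi * (x - b) * u) / Complex.sin (2 * Real.pi * (x - b))
    - Complex.sin (2 * Real.pi * b * u) / Complex.sin (2 * Real.pi * b))
    * Complex.cot (Real.pi * u)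

/-- The integrand of the closed form when `b` is an integer. -/
noncomputable def integerIntegrand (b x : ℂ) (u : ℝ) : ℂ :=
  (Complex.sin (2 * Real.pi * (x - b) * u) / Complex.sin (2 * Real.pi * x)
    - u * Complex.cos (2 * Real.pi * b * u))
    * Complex.cot (Real.pi * u)

/-- The closed form of the generating function, by cases on `b`. The last branch, reached only when
`b` is half of an odd integer, is a placeholder. -/
noncomputable def closedForm (b x : ℂ) : ℂ :=
  open Classical in
  if 2 * b ∉ integers then
    x ^ 2 / (2 * b * (x - b))
      - Real.pi * x * Complex.sin (Real.pi * x) / (2 * Complex.sin (Real.pi * b))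
        * (1 / Complex.sin (Real.pi * (x - b)))
      - Real.pi * x * ∫ u in (0 : ℝ)..1, genericIntegrand b x u
  else if b = 0 then
    1 / 2 - Real.pi * x / 2 * Complex.cot (Real.pi * x)
      - Real.pi * x * ∫ u in (0 : ℝ)..1,
          (Complex.sin (2 * Real.pi * x * u) / Complex.sin (2 * Real.pi * x) - u)
            * Complex.cot (Real.pi * u)
  else if ∃ n : ℕ, 0 < n ∧ b = n then
    x ^ 2 / (2 * b * (x - b)) - Real.pi * x / 2 * Complex.cot (Real.pi * x)
      - Real.pi * x * ∫ u in (0 : ℝ)..1, integerIntegrand b x u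
  else if ∃ n : ℕ, 0 < n ∧ b = -n then
    1 + x ^ 2 / (2 * b * (x - b)) - Real.pi * x / 2 * Complex.cot (Real.pi * x)
      - Real.pi * x * ∫ u in (0 : ℝ)..1, integerIntegrand b x u
  else 0

/-- The closed form with its removable singularity at `0` filled in by the value `0`. -/
noncomputable def genFun (b : ℂ) : ℂ → ℂ := Function.update (closedForm b) 0 0

/-- The hyperbolic integrand, for the series built from `∑_{j ≥ 1} 1 / (i j + b)^k`. -/
noncomputable def hyperbolicIntegrand (b x : ℂ) (u : ℝ) : ℂ :=
  (1 / Complex.sinh (2 * Real.pi * (x - b)) * Complex.sinh (2 * Real.pi * (x - b) * u)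
    - 1 / Complex.sinh (2 * Real.pi * b) * Complex.sinh (2 * Real.pi * b * u))
    * Complex.cot (Real.pi * u)

/-- The hyperbolic closed form, for the series built from `∑_{j ≥ 1} 1 / (i j + b)^k`. -/
noncomputable def hyperbolicForm (b x : ℂ) : ℂ :=
  x ^ 2 / (2 * b * (x - b))
    + Real.pi * x * (Complex.exp (2 * Real.pi * x) - 1)
      / ((Complex.exp (-(2 * Real.pi * b)) - 1)
        * (Complex.exp (2 * Real.pi * x) - Complex.exp (2 * Real.pi * b)))
    + Complex.I * Real.pi * x * ∫ u in (0 : ℝ)..1, hyperbolicIntegrand b x u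

/-- The coefficient `∑_{j ≥ 1} 1 / (i j + b)^k`. -/
noncomputable def rotatedCoeff (k : ℕ) (b : ℂ) : ℂ :=
  ∑' j : ℕ, 1 / (Complex.I * ((j : ℂ) + 1) + b) ^ k

end HurwitzGen

namespace HurwitzGen

/-! Put `v j = 1 / (j + 1 + b)`, read as `0` when the denominator vanishes. The coefficients are the
power sums of `v`, and since `v` is square summable, geometric series and Fubini give the generating
function `G(x) = ∑ⱼ (x vⱼ)² / (1 - x vⱼ)` when all `|x vⱼ| < 1`. The series for `G` makes sense for
every `x` and is analytic wherever no `x vⱼ` equals `1`; everything reduces to identifying `G` with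
the closed form (`closedForm_eq`).

With `y = x - b`, the `j`-th summand is `x (1/(j+1-y) - 1/(j+1+b))`, a digamma difference. Split
each fraction into parts odd and even in its parameter. The odd parts sum to cotangents by the
partial fraction expansion (`tendsto_sum_reflection`). The even parts `1/(j+1+y) + 1/(j+1-y)` are,
up to a constant, the sine coefficients of `sin(2πyu)/sin(2πy)` on `[0,1]`. The difference of two
such functions, for `y` and `b`, vanishes at both endpoints, so the sum of its sine coefficients is
its integral against `cot πu` (`tendsto_sum_integral_mul_sin`). For integer `b` the ratio is
replaced by `u cos(2πbu)`, which has the same coefficients with the singular fraction dropped.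

If the power series converges outside the disc, only finitely many `x vⱼ` have modulus at least `1`;
removing them leaves a convergent combination of their `N`-th powers, whose limit must be `0`. The
hyperbolic form is the trigonometric one rotated by `-i`. -/

/-- A combination of powers of numbers different from `1` can only converge to `0`. -/
lemma eq_zero_of_tendsto_sum_mul_pow {ι : Type*} (w : ι → ℂ) (s : Finset ι) :
    ∀ (c : ι → ℂ) (l : ℂ), (∀ j ∈ s, w j ≠ 1) →
      Tendsto (fun N : ℕ => ∑ j ∈ s, c j * w j ^ N) atTop (𝓝 l) → l = 0 := by
  classical
  induction s using Finset.induction_on with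
  | empty =>
    intro c l _ h
    exact tendsto_nhds_unique h (by simp)
  | insert a s ha ih =>
    intro c l hw h
    -- Shifting `N` and subtracting `w a` times the sequence kills the term of `a` and multiplies
    -- the limit by `1 - w a`.
    have h1 : Tendsto (fun N : ℕ => ∑ j ∈ s, (c j * (w j - w a)) * w j ^ N) atTop
        (𝓝 (l - w a * l)) := by
      refine (((tendsto_add_atTop_iff_nat 1).2 h).sub (h.const_mul (w a))).congr fun N => ?_
      rw [Finset.sum_insert ha, Finset.sum_insert ha, mul_add, Finset.mul_sum,
        add_sub_add_comm, ← Finset.sum_sub_distrib]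
      have : c a * w a ^ (N + 1) - w a * (c a * w a ^ N) = 0 := by ring
      rw [this, zero_add]
      exact Finset.sum_congr rfl fun j _ => by ring
    have h2 := ih _ _ (fun j hj => hw j (Finset.mem_insert_of_mem hj)) h1
    have h3 : (1 - w a) * l = 0 := by rw [← h2]; ring
    exact (mul_eq_zero.1 h3).resolve_left
      (sub_ne_zero.2 (hw a (Finset.mem_insert_self a s)).symm)

/-! ### Power sums of a square-summable sequence and their generating function -/

section Series

variable {v w : ℕ → ℂ}

lemma tendsto_cofinite_zero_of_sq (hv : Summable fun j => ‖v j‖ ^ 2) :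
    Tendsto v cofinite (𝓝 0) := by
  have h := hv.tendsto_cofinite_zero.sqrt
  simp only [Real.sqrt_sq (norm_nonneg _), Real.sqrt_zero] at h
  exact tendsto_zero_iff_norm_tendsto_zero.2 h

lemma summable_pow_of_sq (hv : Summable fun j => ‖v j‖ ^ 2) {k : ℕ} (hk : 2 ≤ k) :
    Summable fun j => v j ^ k := by
  refine Summable.of_norm_bounded_eventually hv ?_
  filter_upwards [(tendsto_cofinite_zero_of_sq hv).norm.eventually_lt_const
    (by simp : ‖(0 : ℂ)‖ < 1)] with j hj
  rw [norm_pow]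
  exact pow_le_pow_of_le_one (norm_nonneg _) hj.le hk

/-- The double series of powers may be summed along the exponent first. -/
lemma hasSum_tsum_pow (hw : Summable fun j => ‖w j‖ ^ 2) (h1 : ∀ j, ‖w j‖ < 1) :
    HasSum (fun k : ℕ => ∑' j, w j ^ (k + 2)) (∑' j, w j ^ 2 / (1 - w j)) := by
  have hgeo : ∀ j, HasSum (fun k : ℕ => ‖w j‖ ^ (k + 2)) (‖w j‖ ^ 2 / (1 - ‖w j‖)) := fun j => by
    have := (hasSum_geometric_of_lt_one (norm_nonneg _) (h1 j)).mul_left (‖w j‖ ^ 2)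
    simpa only [pow_add, mul_comm, div_eq_mul_inv] using this
  have hprod : Summable fun p : ℕ × ℕ => w p.1 ^ (p.2 + 2) := by
    apply Summable.of_norm
    simp only [norm_pow]
    refine (summable_prod_of_nonneg fun p => by positivity).2 ⟨fun j => (hgeo j).summable, ?_⟩
    simp only [(hgeo _).tsum_eq]
    -- Once `‖w j‖ < 1/2`, the denominator is at least `1/2`.
    refine Summable.of_norm_bounded_eventually (hw.mul_left 2) ?_
    filter_upwards [(tendsto_cofinite_zero_of_sq hw).norm.eventually_lt_const
      (by simp : ‖(0 : ℂ)‖ < 1 / 2)] with j hj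
    have hp : 0 < 1 - ‖w j‖ := by linarith
    rw [Real.norm_of_nonneg (by positivity), div_le_iff₀ hp]
    nlinarith [sq_nonneg ‖w j‖]
  have hcol : ∀ j, HasSum (fun k : ℕ => w j ^ (k + 2)) (w j ^ 2 / (1 - w j)) := fun j => by
    have := (hasSum_geometric_of_norm_lt_one (h1 j)).mul_left (w j ^ 2)
    simpa only [pow_add, mul_comm, div_eq_mul_inv] using this
  have e1 : ∑' p : ℕ × ℕ, w p.1 ^ (p.2 + 2) = ∑' j, w j ^ 2 / (1 - w j) := by
    rw [hprod.tsum_prod]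
    exact tsum_congr fun j => (hcol j).tsum_eq
  rw [← e1, ← (Equiv.prodComm ℕ ℕ).tsum_eq]
  have hs := (Equiv.prodComm ℕ ℕ).summable_iff.2 hprod
  exact hs.hasSum.prod_fiberwise fun k => (hs.prod_factor k).hasSum

lemma summable_sq_div (hw : Summable fun j => ‖w j‖ ^ 2) :
    Summable fun j => w j ^ 2 / (1 - w j) := by
  refine Summable.of_norm_bounded_eventually (hw.mul_left 2) ?_
  filter_upwards [(tendsto_cofinite_zero_of_sq hw).norm.eventually_lt_const
    (by simp : ‖(0 : ℂ)‖ < 1 / 2)] with j hj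
  have h2 : 1 / 2 ≤ ‖1 - w j‖ := by
    have := norm_sub_norm_le (1 : ℂ) (w j)
    rw [norm_one] at this
    linarith
  rw [norm_div, norm_pow, div_le_iff₀ (by linarith)]
  nlinarith [sq_nonneg ‖w j‖]

lemma sum_Icc_pow {a : ℂ} (ha : a ≠ 1) (N : ℕ) :
    ∑ k ∈ Finset.Icc 2 (N + 1), a ^ k = a ^ 2 / (1 - a) - a ^ 2 / (1 - a) * a ^ N := by
  have h1 : 1 - a ≠ 0 := sub_ne_zero.2 ha.symm
  induction N with
  | zero => simp
  | succ N ih =>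
    rw [Finset.sum_Icc_succ_top (by omega), ih]
    field_simp
    ring

/-- Whenever the series over the exponent converges, it converges to the expected value, even
outside the disc of convergence. -/
lemma eq_of_tendsto_sum_tsum_pow (hw : Summable fun j => ‖w j‖ ^ 2) (h1 : ∀ j, w j ≠ 1) {s : ℂ}
    (hs : Tendsto (fun N : ℕ => ∑ k ∈ Finset.Icc 2 N, ∑' j, w j ^ k) atTop (𝓝 s)) :
    s = ∑' j, w j ^ 2 / (1 - w j) := by
  classical
  have hfin : {j | ¬ ‖w j‖ < 1}.Finite :=
    (tendsto_cofinite_zero_of_sq hw).norm.eventually_lt_const (by simp : ‖(0 : ℂ)‖ < 1)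
  set S := hfin.toFinset with hS
  -- Zeroing the finitely many large terms makes the exponent series converge unconditionally; the
  -- removed part is a finite geometric sum.
  set w' : ℕ → ℂ := fun j => if j ∈ S then 0 else w j with hw'
  have hle : ∀ j, ‖w' j‖ ≤ ‖w j‖ := fun j => by
    simp only [hw']; split_ifs <;> simp
  have hw's : Summable fun j => ‖w' j‖ ^ 2 :=
    hw.of_nonneg_of_le (fun j => by positivity)
      fun j => pow_le_pow_left₀ (norm_nonneg _) (hle j) 2
  have hlt : ∀ j, ‖w' j‖ < 1 := fun j => by
    by_cases hj : j ∈ S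
    · simp [hw', hj]
    · simp only [hw', hj, if_false]
      simpa [hS] using hj
  have split : ∀ φ : ℂ → ℂ, φ 0 = 0 → Summable (fun j => φ (w j)) →
      ∑' j, φ (w j) = ∑ j ∈ S, φ (w j) + ∑' j, φ (w' j) := fun φ h0 hφ => by
    rw [← hφ.sum_add_tsum_compl (s := S), tsum_subtype (s := (S : Set ℕ)ᶜ) (f := fun j => φ (w j))]
    congr 1
    refine tsum_congr fun j => ?_
    by_cases hj : j ∈ S <;> simp [hw', hj, h0]
  have hT' := hasSum_tsum_pow hw's hlt
  have hpart : Tendsto (fun N : ℕ => ∑ k ∈ Finset.Icc 2 (N + 1), ∑' j, w' j ^ k) atTop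
      (𝓝 (∑' j, w' j ^ 2 / (1 - w' j))) := by
    refine hT'.tendsto_sum_nat.congr fun N => ?_
    rw [← Finset.Ico_add_one_right_eq_Icc, Finset.sum_Ico_eq_sum_range]
    exact Finset.sum_congr (by congr 1) fun k _ => by rw [add_comm]
  have hdiff := ((tendsto_add_atTop_iff_nat 1).2 hs).sub hpart
  -- By `sum_Icc_pow` the removed part is a constant minus this combination of `N`-th powers, so the
  -- combination has a limit, which is then `0`.
  have hexp : Tendsto (fun N : ℕ => ∑ j ∈ S, w j ^ 2 / (1 - w j) * w j ^ N) atTop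
      (𝓝 (∑ j ∈ S, w j ^ 2 / (1 - w j) - (s - ∑' j, w' j ^ 2 / (1 - w' j)))) := by
    refine (tendsto_const_nhds.sub hdiff).congr fun N => ?_
    have hk : ∀ k ∈ Finset.Icc 2 (N + 1),
        ∑' j, w j ^ k - ∑' j, w' j ^ k = ∑ j ∈ S, w j ^ k := fun k hk => by
      have hk2 := (Finset.mem_Icc.1 hk).1
      rw [split (fun z => z ^ k) (zero_pow (by omega)) (summable_pow_of_sq hw hk2)]
      ring
    rw [← Finset.sum_sub_distrib, Finset.sum_congr rfl hk, Finset.sum_comm,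
      ← Finset.sum_sub_distrib]
    exact Finset.sum_congr rfl fun j _ => by rw [sum_Icc_pow (h1 j)]; ring
  have h0 := eq_zero_of_tendsto_sum_mul_pow w S _ _ (fun j _ => h1 j) hexp
  rw [split (fun z => z ^ 2 / (1 - z)) (by simp) (summable_sq_div hw)]
  linear_combination -h0

/-- The generating function `∑ⱼ (x vⱼ)² / (1 - x vⱼ)` of the power sums of a sequence. -/
noncomputable def powerSumGen (v : ℕ → ℂ) (x : ℂ) : ℂ := ∑' j, (x * v j) ^ 2 / (1 - x * v j)

lemma summable_norm_mul_sq (hv : Summable fun j => ‖v j‖ ^ 2) (x : ℂ) :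
    Summable fun j => ‖x * v j‖ ^ 2 := by
  simpa only [norm_mul, mul_pow] using hv.mul_left (‖x‖ ^ 2)

lemma hasSum_powerSumGen (hv : Summable fun j => ‖v j‖ ^ 2) {x : ℂ}
    (hx : ∀ j, ‖x * v j‖ < 1) :
    HasSum (fun k : ℕ => x ^ (k + 2) * ∑' j, v j ^ (k + 2)) (powerSumGen v x) := by
  have h := hasSum_tsum_pow (summable_norm_mul_sq hv x) hx
  unfold powerSumGen
  refine h.congr_fun fun k => ?_
  simp only [mul_pow, tsum_mul_left]

lemma eq_powerSumGen_of_tendsto (hv : Summable fun j => ‖v j‖ ^ 2) {x s : ℂ}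
    (hx : ∀ j, x * v j ≠ 1)
    (hs : Tendsto (fun N : ℕ => ∑ k ∈ Finset.Icc 2 N, x ^ k * ∑' j, v j ^ k) atTop (𝓝 s)) :
    s = powerSumGen v x := by
  refine eq_of_tendsto_sum_tsum_pow (summable_norm_mul_sq hv x) hx ?_
  simpa only [mul_pow, tsum_mul_left] using hs

/-- On a ball of radius `R` the terms with `‖v j‖ < 1 / (2R)` have denominators of norm at least
`1/2` and are dominated by a multiple of `‖v j‖²`; the finitely many others are rational functions
without a pole at `x`. -/
lemma analyticAt_powerSumGen (hv : Summable fun j => ‖v j‖ ^ 2) {x : ℂ}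
    (hx : ∀ j, x * v j ≠ 1) : AnalyticAt ℂ (powerSumGen v) x := by
  obtain ⟨R, hR⟩ := exists_gt ‖x‖
  have hR0 : 0 < R := (norm_nonneg x).trans_lt hR
  obtain ⟨M, hM⟩ : ∃ M : ℕ, ∀ j ≥ M, ‖v j‖ < 1 / (2 * R) := by
    have := tendsto_cofinite_zero_of_sq hv
    rw [Nat.cofinite_eq_atTop] at this
    exact eventually_atTop.1 (this.norm.eventually_lt_const (by simpa using hR0))
  have hden : ∀ j, ∀ z ∈ Metric.ball (0 : ℂ) R, 1 / 2 ≤ ‖1 - z * v (j + M)‖ := fun j z hz => by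
    have hz' : ‖z‖ < R := by simpa using hz
    have h1 := norm_sub_norm_le (1 : ℂ) (z * v (j + M))
    have h2 := hM (j + M) (by omega)
    have h3 : ‖z‖ * ‖v (j + M)‖ ≤ R * (1 / (2 * R)) := by gcongr
    have h4 : R * (1 / (2 * R)) = 1 / 2 := by field_simp
    rw [norm_one, norm_mul] at h1
    linarith
  have hdiff : DifferentiableOn ℂ
      (fun z => ∑' j, (z * v (j + M)) ^ 2 / (1 - z * v (j + M))) (Metric.ball 0 R) := by
    refine Complex.differentiableOn_tsum_of_summable_norm
      (u := fun j => 2 * (R ^ 2 * ‖v (j + M)‖ ^ 2)) ?_ ?_ Metric.isOpen_ball ?_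
    · exact (((summable_nat_add_iff M).2 hv).mul_left _).mul_left _
    · intro j z hz
      have := hden j z hz
      have h0 : 1 - z * v (j + M) ≠ 0 := fun h => by rw [h, norm_zero] at this; norm_num at this
      exact DifferentiableAt.differentiableWithinAt (by fun_prop (disch := exact h0))
    · intro j z hz
      have h1 := hden j z hz
      have hz' : ‖z‖ < R := by simpa using hz
      rw [norm_div, norm_pow, norm_mul, mul_pow, div_le_iff₀ (by linarith)]
      have h2 : ‖z‖ ^ 2 * ‖v (j + M)‖ ^ 2 ≤ R ^ 2 * ‖v (j + M)‖ ^ 2 := by gcongr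
      nlinarith [sq_nonneg ‖v (j + M)‖, mul_nonneg (sq_nonneg R) (sq_nonneg ‖v (j + M)‖)]
  have htail : AnalyticAt ℂ (fun z => ∑' j, (z * v (j + M)) ^ 2 / (1 - z * v (j + M))) x :=
    hdiff.analyticAt (Metric.isOpen_ball.mem_nhds (by simpa using hR))
  have hhead : AnalyticAt ℂ
      (fun z => ∑ j ∈ Finset.range M, (z * v j) ^ 2 / (1 - z * v j)) x := by
    refine Finset.analyticAt_fun_sum _ fun j _ => ?_
    have h0 : 1 - x * v j ≠ 0 := sub_ne_zero.2 (hx j).symm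
    fun_prop (disch := exact h0)
  refine (hhead.add htail).congr (Eventually.of_forall fun z => ?_)
  exact (summable_sq_div (summable_norm_mul_sq hv z)).sum_add_tsum_nat_add M

/-- Near `0` the power sums are the coefficients of a convergent expansion, and power series are
unique. -/
lemma iteratedDeriv_powerSumGen (hv : Summable fun j => ‖v j‖ ^ 2) {k : ℕ} (hk : 2 ≤ k) :
    iteratedDeriv k (powerSumGen v) 0 / (k.factorial : ℂ) = ∑' j, v j ^ k := by
  have hps : HasFPowerSeriesAt (powerSumGen v) (FormalMultilinearSeries.ofScalars ℂ
      fun k => if k < 2 then 0 else ∑' j, v j ^ k) 0 := by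
    rw [hasFPowerSeriesAt_iff]
    obtain ⟨C, hC⟩ := hv.tendsto_cofinite_zero.bddAbove_range_of_cofinite
    -- From `2‖v j‖ ≤ ‖v j‖² + 1`.
    have hC1 : ∀ j, ‖v j‖ ≤ C + 1 := fun j => by
      have : ‖v j‖ ^ 2 ≤ C := hC ⟨j, rfl⟩
      nlinarith [sq_nonneg (‖v j‖ - 1)]
    have hC0 : 0 < C + 1 + 1 := by linarith [hC1 0, norm_nonneg (v 0)]
    filter_upwards [Metric.ball_mem_nhds (0 : ℂ) (one_div_pos.2 hC0)] with z hz
    have hz' : ‖z‖ < 1 / (C + 1 + 1) := by simpa using hz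
    rw [lt_div_iff₀ hC0] at hz'
    have := hasSum_powerSumGen hv (x := z) fun j => by
      rw [norm_mul]
      nlinarith [hC1 j, norm_nonneg z]
    rw [zero_add, ← hasSum_nat_add_iff' 2]
    simpa [Finset.sum_range_succ, FormalMultilinearSeries.coeff_ofScalars] using this
  have h := hps.eq_formalMultilinearSeries hps.analyticAt.hasFPowerSeriesAt
  have h2 := congrArg (fun p => FormalMultilinearSeries.coeff p k) h
  simp only [FormalMultilinearSeries.coeff_ofScalars, if_neg (not_lt.2 hk)] at h2
  exact h2.symm

end Series

/-! ### Sums of sine coefficients as cotangent integrals -/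

section Dirichlet

open Complex Set MeasureTheory
open scoped Real FourierTransform

/-- The conjugate Dirichlet kernel, multiplied by `sin πu` to clear the denominator. -/
lemma sum_sin_mul_sin (u : ℂ) (N : ℕ) :
    (∑ j ∈ Finset.range N, 2 * sin (2 * π * ((j : ℂ) + 1) * u)) * sin (π * u)
      = cos (π * u) - cos ((2 * N + 1) * π * u) := by
  induction N with
  | zero => simp
  | succ N ih =>
    rw [Finset.sum_range_succ, add_mul, ih]
    have h1 : (2 * (N : ℂ) + 1) * π * u = 2 * π * (N + 1) * u - π * u := by ring
    have h2 : (2 * ((N + 1 : ℕ) : ℂ) + 1) * π * u = 2 * π * (N + 1) * u + π * u := by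
      push_cast; ring
    rw [h1, h2, cos_sub, cos_add]
    ring

lemma tendsto_div_of_hasDerivAt {f h : ℝ → ℂ} {f' h' : ℂ} {a : ℝ} (hf : HasDerivAt f f' a)
    (hh : HasDerivAt h h' a) (hf0 : f a = 0) (hh0 : h a = 0) (h'0 : h' ≠ 0) :
    Tendsto (fun u => f u / h u) (𝓝[≠] a) (𝓝 (f' / h')) := by
  refine ((hasDerivAt_iff_tendsto_slope.1 hf).div (hasDerivAt_iff_tendsto_slope.1 hh) h'0).congr' ?_
  filter_upwards [self_mem_nhdsWithin] with u hu
  have hu' : ((u - a : ℝ) : ℂ) ≠ 0 := ofReal_ne_zero.2 (sub_ne_zero.2 hu)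
  simp only [Pi.div_apply, slope, vsub_eq_sub, hf0, hh0, sub_zero, real_smul, ofReal_inv]
  field_simp

lemma hasDerivAt_sin_pi_mul (a : ℝ) :
    HasDerivAt (fun u : ℝ => sin (π * u)) (π * cos (π * a)) a := by
  have h := ((hasDerivAt_id (a : ℂ)).const_mul (π : ℂ)).csin.comp_ofReal
  simpa [mul_comm] using h

lemma sin_pi_mul_ofReal_ne_zero {u : ℝ} (hu : u ∈ Ioo (0 : ℝ) 1) : sin (π * u : ℂ) ≠ 0 := by
  rw [← ofReal_mul, ← ofReal_sin, ofReal_ne_zero]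
  exact (Real.sin_pos_of_pos_of_lt_pi (by have := hu.1; positivity)
    (by nlinarith [hu.2, Real.pi_pos])).ne'

variable {g : ℝ → ℂ}

/-- The zeros of `sin πu` at the endpoints are simple and are cancelled by those of `g`, so the
quotient extends continuously to `[0, 1]`. -/
lemma intervalIntegrable_div_sin (hg : Differentiable ℝ g) (h0 : g 0 = 0) (h1 : g 1 = 0) :
    IntervalIntegrable (fun u => g u / sin (π * u)) volume 0 1 := by
  have hq : ContinuousOn (fun u => g u / sin (π * u)) (Ioo 0 1) :=
    hg.continuous.continuousOn.div (by fun_prop) fun u hu => sin_pi_mul_ofReal_ne_zero hu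
  have hpi : (π : ℂ) ≠ 0 := ofReal_ne_zero.2 Real.pi_ne_zero
  have ha := tendsto_div_of_hasDerivAt (hg 0).hasDerivAt (hasDerivAt_sin_pi_mul 0) h0 (by simp)
    (by simp [hpi])
  have hb := tendsto_div_of_hasDerivAt (hg 1).hasDerivAt (hasDerivAt_sin_pi_mul 1) h1 (by simp)
    (by simp [hpi])
  have hc := continuousOn_Icc_extendFrom_Ioo hq
    (ha.mono_left (nhdsWithin_mono _ fun u hu => (ne_of_gt hu : u ≠ 0)))
    (hb.mono_left (nhdsWithin_mono _ fun u hu => (ne_of_lt hu : u ≠ 1)))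
  rw [intervalIntegrable_iff_integrableOn_Ioo_of_le zero_le_one]
  refine ((hc.integrableOn_Icc).mono_set Ioo_subset_Icc_self).congr_fun (fun u hu => ?_)
    measurableSet_Ioo
  exact extendFrom_eq (by rw [closure_Ioo zero_ne_one]; exact Ioo_subset_Icc_self hu) (hq u hu)

lemma mul_cot_eq (g : ℝ → ℂ) (u : ℝ) :
    g u * cot (π * u) = g u / sin (π * u) * cos (π * u) := by
  rw [cot]; ring

lemma intervalIntegrable_mul_cot (hg : Differentiable ℝ g) (h0 : g 0 = 0) (h1 : g 1 = 0) :
    IntervalIntegrable (fun u => g u * cot (π * u)) volume 0 1 := by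
  simp only [mul_cot_eq]
  exact (intervalIntegrable_div_sin hg h0 h1).mul_continuousOn (by fun_prop)

/-- Riemann–Lebesgue at the frequencies `±(N + 1/2)`, whose exponentials average to the cosine. -/
lemma tendsto_integral_mul_cos (q : ℝ → ℂ) (hq : IntervalIntegrable q volume 0 1) :
    Tendsto (fun N : ℕ => ∫ u in (0 : ℝ)..1, q u * cos ((2 * N + 1) * π * u)) atTop (𝓝 0) := by
  have hRL := Real.tendsto_integral_exp_smul_cocompact (indicator (Ioc (0 : ℝ) 1) q)
  have hint : ∀ w : ℝ, ∫ v : ℝ, 𝐞 (-(v * w)) • indicator (Ioc (0 : ℝ) 1) q v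
      = ∫ u in (0 : ℝ)..1, q u * exp (-(2 * π * w * u) * I) := fun w => by
    rw [intervalIntegral.integral_of_le zero_le_one, ← integral_indicator measurableSet_Ioc]
    refine integral_congr_ae (Eventually.of_forall fun u => ?_)
    by_cases hu : u ∈ Ioc (0 : ℝ) 1
    · simp only [indicator_of_mem hu, Circle.smul_def, Real.fourierChar_apply, smul_eq_mul]
      rw [mul_comm]
      congr 2
      push_cast
      ring
    · simp [indicator_of_notMem hu]
  simp only [hint] at hRL
  have hN : Tendsto (fun N : ℕ => (N : ℝ) + 1 / 2) atTop atTop :=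
    tendsto_atTop_add_const_right _ _ tendsto_natCast_atTop_atTop
  have hp := hRL.comp (hN.mono_right atTop_le_cocompact)
  have hm := hRL.comp ((tendsto_neg_atTop_atBot.comp hN).mono_right atBot_le_cocompact)
  have := (hp.add hm).div_const 2
  simp only [add_zero, zero_div] at this
  refine this.congr fun N => ?_
  have hi : ∀ w : ℝ, IntervalIntegrable (fun u : ℝ => q u * exp (-(2 * π * w * u) * I))
      volume 0 1 := fun w => hq.mul_continuousOn (by fun_prop)
  simp only [Function.comp_apply]
  rw [← intervalIntegral.integral_add (hi _) (hi _), ← intervalIntegral.integral_div]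
  refine intervalIntegral.integral_congr fun u _ => ?_
  have e1 : -(2 * π * ((N + 1 / 2 : ℝ) : ℂ) * u) * I = -((2 * N + 1) * π * u) * I := by
    push_cast; ring
  have e2 : -(2 * π * ((-(N + 1 / 2) : ℝ) : ℂ) * u) * I = ((2 * N + 1) * π * u) * I := by
    push_cast; ring
  simp only [e1, e2, cos]
  ring

/-- The integral of `g` against the cotangent is the sum of the sine coefficients of `g`. -/
lemma tendsto_sum_integral_mul_sin (hg : Differentiable ℝ g) (h0 : g 0 = 0) (h1 : g 1 = 0) :
    Tendsto (fun N : ℕ => ∑ j ∈ Finset.range N,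
        2 * ∫ u in (0 : ℝ)..1, g u * sin (2 * π * ((j : ℂ) + 1) * u)) atTop
      (𝓝 (∫ u in (0 : ℝ)..1, g u * cot (π * u))) := by
  have hq := intervalIntegrable_div_sin hg h0 h1
  have hcont := hg.continuous
  have hlim := (tendsto_integral_mul_cos _ hq).const_sub (∫ u in (0 : ℝ)..1, g u * cot (π * u))
  rw [sub_zero] at hlim
  refine hlim.congr fun N => ?_
  simp only [mul_cot_eq]
  rw [← intervalIntegral.integral_sub (hq.mul_continuousOn (by fun_prop))
    (hq.mul_continuousOn (by fun_prop))]
  simp only [← intervalIntegral.integral_const_mul]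
  rw [← intervalIntegral.integral_finsetSum
    fun j _ => (by fun_prop : Continuous _).intervalIntegrable _ _]
  refine intervalIntegral.integral_congr fun u hu => ?_
  rw [uIcc_of_le zero_le_one] at hu
  have hsum : ∑ j ∈ Finset.range N, 2 * (g u * sin (2 * π * ((j : ℂ) + 1) * u))
      = g u * ∑ j ∈ Finset.range N, 2 * sin (2 * π * ((j : ℂ) + 1) * u) := by
    rw [Finset.mul_sum]
    exact Finset.sum_congr rfl fun j _ => by ring
  simp only [hsum, ← mul_sub]
  rw [← sum_sin_mul_sin]
  rcases eq_endpoints_or_mem_Ioo_of_mem_Icc hu with rfl | rfl | hu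
  · simp [h0]
  · simp [h1]
  · have := sin_pi_mul_ofReal_ne_zero hu
    field_simp

end Dirichlet

/-! ### Sine coefficients and the digamma difference -/

open Complex
open scoped Real

lemma ne_intCast_of_two_mul_notMem {b : ℂ} (hb : 2 * b ∉ integers) (n : ℤ) : b ≠ n := by
  rintro rfl
  exact hb ⟨2 * n, by push_cast; ring⟩

lemma two_mul_mem_integers {b : ℂ} (hb : b ∈ integers) : 2 * b ∈ integers := by
  obtain ⟨n, rfl⟩ := hb
  exact ⟨2 * n, by push_cast; ring⟩

lemma pi_ne_zero' : (π : ℂ) ≠ 0 := ofReal_ne_zero.2 Real.pi_ne_zero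

lemma sin_two_pi_mul_ne_zero {b : ℂ} (hb : 2 * b ∉ integers) : sin (2 * π * b) ≠ 0 := by
  intro h
  obtain ⟨k, hk⟩ := sin_eq_zero_iff.1 h
  refine hb ⟨k, mul_right_cancel₀ pi_ne_zero' ?_⟩
  linear_combination -hk

lemma sin_pi_mul_ne_zero_of_notMem {b : ℂ} (hb : 2 * b ∉ integers) : sin (π * b) ≠ 0 := by
  intro h
  apply sin_two_pi_mul_ne_zero hb
  rw [show 2 * π * b = 2 * (π * b) by ring, sin_two_mul, h]
  ring

open Classical in
/-- The function on `[0, 1]` running from `0` to `1` whose sine coefficients give the even part of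
the digamma series. -/
noncomputable def sineRatio (b : ℂ) (u : ℝ) : ℂ :=
  if 2 * b ∈ integers then u * cos (2 * π * b * u) else sin (2 * π * b * u) / sin (2 * π * b)

lemma sineRatio_of_notMem {b : ℂ} (hb : 2 * b ∉ integers) :
    sineRatio b = fun u : ℝ => sin (2 * π * b * u) / sin (2 * π * b) := by
  funext u; rw [sineRatio, if_neg hb]

lemma sineRatio_of_mem {b : ℂ} (hb : b ∈ integers) :
    sineRatio b = fun u : ℝ => (u : ℂ) * cos (2 * π * b * u) := by
  funext u; rw [sineRatio, if_pos (two_mul_mem_integers hb)]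

lemma differentiable_sineRatio (b : ℂ) : Differentiable ℝ (sineRatio b) := by
  have hu : Differentiable ℝ (fun u : ℝ => (u : ℂ)) := ofRealCLM.differentiable
  have hm : Differentiable ℝ (fun u : ℝ => 2 * π * b * (u : ℂ)) := hu.const_mul _
  unfold sineRatio
  split_ifs
  · exact hu.mul ((differentiable_cos.restrictScalars ℝ).comp hm)
  · exact ((differentiable_sin.restrictScalars ℝ).comp hm).div_const _

lemma sineRatio_zero (b : ℂ) : sineRatio b 0 = 0 := by simp [sineRatio]

/-- This is where half-odd `b` must be excluded: there `u cos(2πbu)` equals `-1` at `u = 1`. -/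
lemma sineRatio_one {b : ℂ} (hb : 2 * b ∉ integers ∨ b ∈ integers) : sineRatio b 1 = 1 := by
  rcases hb with hb | hb
  · simp [sineRatio_of_notMem hb, sin_two_pi_mul_ne_zero hb]
  · rw [sineRatio_of_mem hb]
    obtain ⟨n, rfl⟩ := hb
    have : (2 * π * (n : ℂ) * ((1 : ℝ) : ℂ)) = n * (2 * π) := by push_cast; ring
    simp only [this, cos_int_mul_two_pi]
    simp

lemma integral_mul_sin_two_pi_int (m : ℤ) :
    ∫ u in (0 : ℝ)..1, (u : ℂ) * sin (2 * π * m * u) = -1 / (2 * π * m) := by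
  rcases eq_or_ne m 0 with rfl | hm
  · simp
  have hm' : (m : ℂ) ≠ 0 := Int.cast_ne_zero.2 hm
  have hc : (2 * π * m : ℂ) ≠ 0 := by simp [hm']
  set c : ℂ := 2 * π * m with hcdef
  have hd : ∀ u ∈ Set.uIcc (0 : ℝ) 1, HasDerivAt
      (fun u : ℝ => -((u : ℂ) * cos (c * u)) / c + sin (c * u) / c ^ 2) ((u : ℂ) * sin (c * u)) u := by
    intro u _
    have hid := hasDerivAt_id (u : ℂ)
    have h := ((((hid.mul (hid.const_mul c).ccos).neg.div_const c).add
      ((hid.const_mul c).csin.div_const (c ^ 2)))).comp_ofReal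
    refine h.congr_deriv ?_
    simp only [id]
    field_simp
    ring
  rw [intervalIntegral.integral_eq_sub_of_hasDerivAt hd
    ((by fun_prop : Continuous _).intervalIntegrable _ _)]
  have e1 : cos c = 1 := by
    rw [hcdef, show 2 * π * (m : ℂ) = m * (2 * π) by ring, cos_int_mul_two_pi]
  have e2 : sin c = 0 := by
    rw [hcdef, show 2 * π * (m : ℂ) = ((2 * m : ℤ) : ℂ) * π by push_cast; ring, sin_int_mul_pi]
  simp [e1, e2]

/-- Product-to-sum formulas. For integer `b` a resonant frequency `j + 1 = ±b` integrates to `0`, in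
agreement with `1 / 0 = 0`. -/
lemma integral_sineRatio_mul_sin {b : ℂ} (hb : 2 * b ∉ integers ∨ b ∈ integers) (j : ℕ) :
    2 * ∫ u in (0 : ℝ)..1, sineRatio b u * sin (2 * π * ((j : ℂ) + 1) * u)
      = -(1 / (2 * π)) * (1 / ((j : ℂ) + 1 + b) + 1 / ((j : ℂ) + 1 - b)) := by
  have hpi := pi_ne_zero'
  rcases hb with hb | hb
  · rw [sineRatio_of_notMem hb]
    have hs := sin_two_pi_mul_ne_zero hb
    have hp : (j : ℂ) + 1 + b ≠ 0 := fun h =>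
      ne_intCast_of_two_mul_notMem hb (-(j + 1)) (by push_cast; linear_combination h)
    have hm : (j : ℂ) + 1 - b ≠ 0 := fun h =>
      ne_intCast_of_two_mul_notMem hb (j + 1) (by push_cast; linear_combination -h)
    have hcp : 2 * π * (j + 1 + b) ≠ 0 := by simp [hpi, hp]
    have hcm : 2 * π * (j + 1 - b) ≠ 0 := by simp [hpi, hm]
    have hint : ∀ u : ℝ, sin (2 * π * b * u) / sin (2 * π * b) * sin (2 * π * ((j : ℂ) + 1) * u)
        = (1 / (2 * sin (2 * π * b)))
          * (cos (2 * π * (j + 1 - b) * u) - cos (2 * π * (j + 1 + b) * u)) := fun u => by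
      have e1 : 2 * π * (j + 1 - b) * (u : ℂ) = 2 * π * (j + 1) * u - 2 * π * b * u := by ring
      have e2 : 2 * π * (j + 1 + b) * (u : ℂ) = 2 * π * (j + 1) * u + 2 * π * b * u := by ring
      rw [e1, e2, cos_sub, cos_add]
      field_simp
      ring
    simp only [hint]
    rw [intervalIntegral.integral_const_mul, intervalIntegral.integral_sub
      ((by fun_prop : Continuous _).intervalIntegrable _ _)
      ((by fun_prop : Continuous _).intervalIntegrable _ _),
      integral_cos_mul_complex hcm, integral_cos_mul_complex hcp]
    have s1 : sin (2 * π * (j + 1 - b) * (1 : ℝ)) = -sin (2 * π * b) := by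
      rw [← sin_neg, ← sin_add_nat_mul_two_pi (-(2 * π * b)) (j + 1)]
      congr 1; push_cast; ring
    have s2 : sin (2 * π * (j + 1 + b) * (1 : ℝ)) = sin (2 * π * b) := by
      rw [← sin_add_nat_mul_two_pi (2 * π * b) (j + 1)]
      congr 1; push_cast; ring
    rw [s1, s2]
    simp only [ofReal_zero, mul_zero, sin_zero, zero_div, sub_zero]
    field_simp
    ring
  · rw [sineRatio_of_mem hb]
    obtain ⟨n, rfl⟩ := hb
    have hint : ∀ u : ℝ, (u : ℂ) * cos (2 * π * (n : ℂ) * u) * sin (2 * π * ((j : ℂ) + 1) * u)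
        = (1 / 2) * ((u : ℂ) * sin (2 * π * ((j + 1 + n : ℤ) : ℂ) * u)
          + (u : ℂ) * sin (2 * π * ((j + 1 - n : ℤ) : ℂ) * u)) := fun u => by
      have e1 : 2 * π * ((j + 1 + n : ℤ) : ℂ) * (u : ℂ)
          = 2 * π * (j + 1) * u + 2 * π * n * u := by push_cast; ring
      have e2 : 2 * π * ((j + 1 - n : ℤ) : ℂ) * (u : ℂ)
          = 2 * π * (j + 1) * u - 2 * π * n * u := by push_cast; ring
      rw [e1, e2, sin_sub, sin_add]
      ring
    simp only [hint]
    rw [intervalIntegral.integral_const_mul, intervalIntegral.integral_add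
      ((by fun_prop : Continuous _).intervalIntegrable _ _)
      ((by fun_prop : Continuous _).intervalIntegrable _ _),
      integral_mul_sin_two_pi_int, integral_mul_sin_two_pi_int]
    push_cast
    have hdiv : ∀ m : ℂ, -1 / (2 * π * m) = -(1 / (2 * π)) * (1 / m) := fun m => by ring
    rw [hdiv, hdiv]
    ring

lemma cot_pi_mul_intCast (n : ℤ) : cot (π * n) = 0 := by
  rw [cot, mul_comm, sin_int_mul_pi, div_zero]

/-- Replaces the cotangent expansion at its poles. Passing from `n` to `n + 1` shifts both
progressions by one, so the change telescopes; the singular term counts as `1 / 0 = 0` throughout.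
-/
lemma tendsto_sum_reflection_natCast (n : ℕ) :
    Tendsto (fun N : ℕ => ∑ j ∈ Finset.range N,
      (1 / ((j : ℂ) + 1 - n) - 1 / ((j : ℂ) + 1 + n))) atTop (𝓝 (1 / (n : ℂ))) := by
  induction n with
  | zero => simp
  | succ n ih =>
    have hinv : Tendsto (fun N : ℕ => 1 / ((N : ℂ) - n)) atTop (𝓝 0) := by
      rw [← tendsto_add_atTop_iff_nat n]
      simpa using tendsto_inv_atTop_nhds_zero_nat (𝕜 := ℂ)
    have hinv' : Tendsto (fun N : ℕ => 1 / ((N : ℂ) + 1 + n)) atTop (𝓝 0) := by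
      have := (tendsto_add_atTop_iff_nat (n + 1)).2 (tendsto_inv_atTop_nhds_zero_nat (𝕜 := ℂ))
      refine this.congr fun N => ?_
      rw [one_div]
      push_cast
      congr 1
      ring
    have hlim := (ih.sub hinv).sub hinv'
    have hlim2 := hlim.add_const (1 / ((0 : ℂ) - n) + 1 / ((0 : ℂ) + 1 + n))
    have e : 1 / (n : ℂ) - 0 - 0 + (1 / ((0 : ℂ) - n) + 1 / ((0 : ℂ) + 1 + n))
        = 1 / ((n + 1 : ℕ) : ℂ) := by
      push_cast
      rw [zero_sub, zero_add, add_comm (1 : ℂ), one_div_neg_eq_neg_one_div]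
      ring
    rw [e] at hlim2
    refine hlim2.congr fun N => ?_
    have t1 := Finset.sum_range_sub (fun j : ℕ => 1 / ((j : ℂ) - n)) N
    have t2 := Finset.sum_range_sub (fun j : ℕ => 1 / ((j : ℂ) + 1 + n)) N
    have key : ∑ j ∈ Finset.range N, (1 / ((j : ℂ) + 1 - (n + 1 : ℕ)) - 1 / ((j : ℂ) + 1 + (n + 1 : ℕ)))
        = ∑ j ∈ Finset.range N, (1 / ((j : ℂ) + 1 - n) - 1 / ((j : ℂ) + 1 + n))
          - ∑ j ∈ Finset.range N, (1 / (((j + 1 : ℕ) : ℂ) - n) - 1 / ((j : ℂ) - n))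
          - ∑ j ∈ Finset.range N,
            (1 / (((j + 1 : ℕ) : ℂ) + 1 + n) - 1 / ((j : ℂ) + 1 + n)) := by
      rw [← Finset.sum_sub_distrib, ← Finset.sum_sub_distrib]
      refine Finset.sum_congr rfl fun j _ => ?_
      push_cast
      rw [show (j : ℂ) + 1 - (n + 1) = j - n by ring,
        show (j : ℂ) + 1 + (n + 1) = j + 1 + 1 + n by ring]
      ring
    rw [key, t1, t2]
    push_cast
    ring

lemma tendsto_sum_reflection {b : ℂ} (hb : 2 * b ∉ integers ∨ b ∈ integers) :
    Tendsto (fun N : ℕ => ∑ j ∈ Finset.range N,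
      (1 / ((j : ℂ) + 1 - b) - 1 / ((j : ℂ) + 1 + b))) atTop
      (𝓝 (1 / b - π * cot (π * b))) := by
  rcases hb with hb | ⟨n, rfl⟩
  · have hc : b ∈ Complex.integerComplement := fun ⟨n, hn⟩ =>
      ne_intCast_of_two_mul_notMem hb n hn.symm
    have h := (tendsto_logDeriv_euler_cot_sub hc).neg
    rw [neg_sub] at h
    refine h.congr fun N => ?_
    rw [← Finset.sum_neg_distrib]
    refine Finset.sum_congr rfl fun j _ => ?_
    rw [cotTerm, ← neg_sub ((j : ℂ) + 1) b, one_div_neg_eq_neg_one_div, add_comm b]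
    ring
  · rw [cot_pi_mul_intCast, mul_zero, sub_zero]
    obtain ⟨m, rfl | rfl⟩ := n.eq_nat_or_neg
    · simpa using tendsto_sum_reflection_natCast m
    · have h := (tendsto_sum_reflection_natCast m).neg
      simp only [Int.cast_neg, Int.cast_natCast, one_div_neg_eq_neg_one_div]
      refine h.congr fun N => ?_
      rw [← Finset.sum_neg_distrib]
      refine Finset.sum_congr rfl fun j _ => ?_
      rw [sub_neg_eq_add, ← sub_eq_add_neg]
      ring

lemma sineRatio_sub_zero (b y : ℂ) : sineRatio y 0 - sineRatio b 0 = 0 := by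
  rw [sineRatio_zero, sineRatio_zero, sub_self]

lemma sineRatio_sub_one {b y : ℂ} (hb : 2 * b ∉ integers ∨ b ∈ integers) (hy : 2 * y ∉ integers) :
    sineRatio y 1 - sineRatio b 1 = 0 := by
  rw [sineRatio_one hb, sineRatio_one (Or.inl hy), sub_self]

lemma intervalIntegrable_sineRatio_mul_cot {b y : ℂ} (hb : 2 * b ∉ integers ∨ b ∈ integers)
    (hy : 2 * y ∉ integers) :
    IntervalIntegrable (fun u : ℝ => (sineRatio y u - sineRatio b u) * cot (π * u))
      MeasureTheory.volume 0 1 :=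
  intervalIntegrable_mul_cot ((differentiable_sineRatio y).sub (differentiable_sineRatio b))
    (sineRatio_sub_zero b y) (sineRatio_sub_one hb hy)

/-- Half the sum of the two reflection series supplies the odd parts, and `-π` times the
sine-coefficient series of `sineRatio y - sineRatio b` the even ones; the unwanted fractions with
`+y` and `-b` cancel. -/
lemma tendsto_sum_digamma {b y : ℂ} (hb : 2 * b ∉ integers ∨ b ∈ integers)
    (hy : 2 * y ∉ integers) :
    Tendsto (fun N : ℕ => ∑ j ∈ Finset.range N,
      (1 / ((j : ℂ) + 1 - y) - 1 / ((j : ℂ) + 1 + b))) atTop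
      (𝓝 ((1 / y + 1 / b) / 2 - π / 2 * (cot (π * y) + cot (π * b))
        - π * ∫ u in (0 : ℝ)..1, (sineRatio y u - sineRatio b u) * cot (π * u))) := by
  have hI := tendsto_sum_integral_mul_sin
    ((differentiable_sineRatio y).sub (differentiable_sineRatio b))
    (sineRatio_sub_zero b y) (sineRatio_sub_one hb hy)
  have hlim := (((tendsto_sum_reflection (Or.inl hy)).add (tendsto_sum_reflection hb)).div_const
    2).sub (hI.const_mul (π : ℂ))
  have e : (1 / y - π * cot (π * y) + (1 / b - π * cot (π * b))) / 2
        - π * (∫ u in (0 : ℝ)..1, (sineRatio y - sineRatio b) u * cot (π * u))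
      = (1 / y + 1 / b) / 2 - π / 2 * (cot (π * y) + cot (π * b))
        - π * ∫ u in (0 : ℝ)..1, (sineRatio y u - sineRatio b u) * cot (π * u) := by
    simp only [Pi.sub_apply]
    ring
  rw [e] at hlim
  refine hlim.congr fun N => ?_
  rw [← Finset.sum_add_distrib, Finset.sum_div, Finset.mul_sum, ← Finset.sum_sub_distrib]
  refine Finset.sum_congr rfl fun j _ => ?_
  have hcy := (differentiable_sineRatio y).continuous
  have hcb := (differentiable_sineRatio b).continuous
  have hsplit : 2 * ∫ u in (0 : ℝ)..1, (sineRatio y - sineRatio b) u * sin (2 * π * ((j : ℂ) + 1) * u)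
      = 2 * (∫ u in (0 : ℝ)..1, sineRatio y u * sin (2 * π * ((j : ℂ) + 1) * u))
        - 2 * ∫ u in (0 : ℝ)..1, sineRatio b u * sin (2 * π * ((j : ℂ) + 1) * u) := by
    simp only [Pi.sub_apply, sub_mul]
    rw [intervalIntegral.integral_sub ((by fun_prop : Continuous _).intervalIntegrable _ _)
      ((by fun_prop : Continuous _).intervalIntegrable _ _)]
    ring
  rw [hsplit, integral_sineRatio_mul_sin (Or.inl hy), integral_sineRatio_mul_sin hb]
  have hpi := pi_ne_zero'
  generalize 1 / ((j : ℂ) + 1 - y) = p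
  generalize 1 / ((j : ℂ) + 1 + y) = q
  generalize 1 / ((j : ℂ) + 1 - b) = r
  generalize 1 / ((j : ℂ) + 1 + b) = s
  field_simp
  ring

/-! ### The closed form as a power-sum generating function -/

/-- The reciprocals `1 / (j + 1 + b)`, with a vanishing denominator giving `0`. -/
noncomputable def shiftInv (b : ℂ) (j : ℕ) : ℂ := ((j : ℂ) + 1 + b)⁻¹

lemma summable_shiftInv_sq (b : ℂ) : Summable fun j => ‖shiftInv b j‖ ^ 2 := by
  have hsum : Summable fun j : ℕ => 4 * (1 / ((j + 1 : ℕ) : ℝ) ^ 2) :=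
    ((summable_nat_add_iff 1).2 (Real.summable_one_div_nat_pow.2 one_lt_two)).mul_left 4
  refine Summable.of_norm_bounded_eventually_nat hsum ?_
  -- For `j ≥ 2‖b‖` the denominator has norm at least `(j + 1) / 2`, whence the constant `4`.
  filter_upwards [tendsto_natCast_atTop_atTop.eventually_ge_atTop (2 * ‖b‖)] with j hj
  have h1 : ((j : ℝ) + 1) / 2 ≤ ‖(j : ℂ) + 1 + b‖ := by
    have h := norm_sub_norm_le ((j : ℂ) + 1) (-b)
    rw [sub_neg_eq_add, norm_neg] at h
    have h2 : ‖(j : ℂ) + 1‖ = j + 1 := by exact_mod_cast norm_natCast (j + 1)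
    linarith
  rw [Real.norm_of_nonneg (by positivity), shiftInv, norm_inv, inv_pow]
  have h3 : 4 * (1 / ((j + 1 : ℕ) : ℝ) ^ 2) = ((((j : ℝ) + 1) / 2) ^ 2)⁻¹ := by
    push_cast; field_simp; norm_num
  rw [h3]
  gcongr

lemma sub_mem_of_integers {b x : ℂ} (hb : b ∈ integers) (hx : 2 * (x - b) ∉ integers) :
    2 * x ∉ integers := by
  obtain ⟨n, rfl⟩ := hb
  rintro ⟨m, hm⟩
  refine hx ⟨m - 2 * n, ?_⟩
  push_cast
  simp only at hm ⊢
  rw [hm]; ring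

lemma ne_one_of_notMem {b x : ℂ} (hx : 2 * (x - b) ∉ integers) (j : ℕ) :
    x * shiftInv b j ≠ 1 := by
  intro h
  have hne : (j : ℂ) + 1 + b ≠ 0 := fun h0 => by simp [shiftInv, h0] at h
  rw [shiftInv, mul_inv_eq_one₀ hne] at h
  exact ne_intCast_of_two_mul_notMem hx (j + 1) (by rw [h]; push_cast; ring)

lemma mul_digamma_term {b x : ℂ} (hx : 2 * (x - b) ∉ integers) (j : ℕ) (hj : (j : ℂ) + 1 + b ≠ 0) :
    x * (1 / ((j : ℂ) + 1 - (x - b)) - 1 / ((j : ℂ) + 1 + b))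
      = (x * shiftInv b j) ^ 2 / (1 - x * shiftInv b j) := by
  have h1 := ne_one_of_notMem hx j
  have h2 : (j : ℂ) + 1 - (x - b) ≠ 0 := fun h =>
    ne_intCast_of_two_mul_notMem hx (j + 1) (by push_cast; linear_combination -h)
  have h3 : 1 - x * shiftInv b j = ((j : ℂ) + 1 - (x - b)) / ((j : ℂ) + 1 + b) := by
    rw [shiftInv]; field_simp; ring
  rw [h3, shiftInv]
  field_simp
  ring

/-- The common value of the branches of the closed form, without the correction for negative
integers. -/
noncomputable def digammaForm (b x : ℂ) : ℂ :=
  x * ((1 / (x - b) + 1 / b) / 2 - π / 2 * (cot (π * (x - b)) + cot (π * b))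
    - π * ∫ u in (0 : ℝ)..1, (sineRatio (x - b) u - sineRatio b u) * cot (π * u))

lemma tendsto_powerSumGen_sum (b x : ℂ) : Tendsto (fun N : ℕ => ∑ j ∈ Finset.range N,
    (x * shiftInv b j) ^ 2 / (1 - x * shiftInv b j)) atTop (𝓝 (powerSumGen (shiftInv b) x)) :=
  (summable_sq_div (summable_norm_mul_sq (summable_shiftInv_sq b) x)).hasSum.tendsto_sum_nat

lemma digammaForm_eq {b x : ℂ} (hb : 2 * b ∉ integers ∨ b ∈ integers)
    (hx : 2 * (x - b) ∉ integers) (h0 : ∀ j : ℕ, (j : ℂ) + 1 + b ≠ 0) :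
    digammaForm b x = powerSumGen (shiftInv b) x := by
  refine tendsto_nhds_unique ((tendsto_sum_digamma hb hx).const_mul x) ?_
  refine (tendsto_powerSumGen_sum b x).congr fun N => ?_
  rw [Finset.mul_sum]
  exact Finset.sum_congr rfl fun j _ => (mul_digamma_term hx j (h0 j)).symm

/-- The index `j = n - 1` is absent from the power sums, but the digamma sum keeps `x (1/(-x) - 1/0)
= -1` there; the added `1` cancels it. -/
lemma one_add_digammaForm_eq {b x : ℂ} {n : ℕ} (hn : 0 < n) (hbn : b = -n)
    (hx : 2 * (x - b) ∉ integers) :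
    1 + digammaForm b x = powerSumGen (shiftInv b) x := by
  have hb : b ∈ integers := ⟨-n, by rw [hbn]; push_cast; rfl⟩
  have hx0 : x ≠ 0 := by
    rintro rfl
    exact sub_mem_of_integers hb hx ⟨0, by simp⟩
  refine tendsto_nhds_unique
    (((tendsto_sum_digamma (Or.inr hb) hx).const_mul x).const_add 1) ?_
  refine (tendsto_powerSumGen_sum b x).congr' ?_
  filter_upwards [eventually_ge_atTop n] with N hN
  have hmem : n - 1 ∈ Finset.range N := Finset.mem_range.2 (by omega)
  have hn1 : ((n - 1 : ℕ) : ℂ) + 1 = n := by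
    rw [Nat.cast_sub hn, Nat.cast_one]; ring
  rw [Finset.mul_sum, ← Finset.add_sum_erase _ _ hmem, ← Finset.add_sum_erase _ _ hmem, ← add_assoc,
    hn1, hbn]
  have e1 : shiftInv (-(n : ℂ)) (n - 1) = 0 := by rw [shiftInv, hn1]; simp
  rw [e1]
  have e2 : 1 + x * (1 / ((n : ℂ) - (x - -(n : ℂ))) - 1 / ((n : ℂ) + -(n : ℂ))) = 0 := by
    have : (n : ℂ) - (x - -(n : ℂ)) = -x := by ring
    rw [this, add_neg_cancel]
    field_simp
    simp
  rw [e2]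
  simp only [mul_zero, ne_eq, OfNat.ofNat_ne_zero, not_false_eq_true, zero_pow, zero_div, zero_add]
  refine Finset.sum_congr rfl fun j hj => ?_
  rw [← hbn]
  refine (mul_digamma_term hx j fun h => (Finset.mem_erase.1 hj).1 ?_).symm
  have : ((j + 1 : ℕ) : ℂ) = n := by push_cast; linear_combination h + (-1 : ℂ) * hbn
  have := Nat.cast_injective this
  omega

lemma cot_pi_mul_sub_intCast (x : ℂ) (n : ℤ) : cot (π * (x - n)) = cot (π * x) := by
  have h : (π * (x - n) : ℂ) = π * x - n * π := by ring
  have hc : cos (n * π) ≠ 0 := fun hc => by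
    have := sin_sq_add_cos_sq (n * π : ℂ)
    rw [hc, sin_int_mul_pi] at this
    norm_num at this
  rw [cot, cot, h, cos_sub, sin_sub, sin_int_mul_pi, mul_zero, mul_zero, add_zero, sub_zero,
    mul_div_mul_right _ _ hc]

lemma integerIntegrand_eq {b x : ℂ} (hb : b ∈ integers) (hx : 2 * (x - b) ∉ integers) :
    integerIntegrand b x = fun u : ℝ => (sineRatio (x - b) u - sineRatio b u) * cot (π * u) := by
  funext u
  rw [sineRatio_of_notMem hx, sineRatio_of_mem hb, integerIntegrand]
  obtain ⟨n, rfl⟩ := hb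
  have : 2 * π * (x - n) = 2 * π * x - n * (2 * π) := by ring
  simp only [this, sin_sub_int_mul_two_pi]

lemma genericIntegrand_eq {b x : ℂ} (hb : 2 * b ∉ integers) (hx : 2 * (x - b) ∉ integers) :
    genericIntegrand b x = fun u : ℝ => (sineRatio (x - b) u - sineRatio b u) * cot (π * u) := by
  funext u
  rw [sineRatio_of_notMem hx, sineRatio_of_notMem hb, genericIntegrand]

lemma digammaForm_of_mem {b x : ℂ} (hb : b ∈ integers) (hx : 2 * (x - b) ∉ integers) :
    digammaForm b x = x * ((1 / (x - b) + 1 / b) / 2) - π * x / 2 * cot (π * x)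
      - π * x * ∫ u in (0 : ℝ)..1, integerIntegrand b x u := by
  rw [digammaForm, ← integerIntegrand_eq hb hx]
  obtain ⟨n, rfl⟩ := hb
  simp only [cot_pi_mul_sub_intCast, cot_pi_mul_intCast]
  ring

lemma mul_inv_add_inv_eq {b x : ℂ} (hb : b ≠ 0) (hx : x - b ≠ 0) :
    x * ((1 / (x - b) + 1 / b) / 2) = x ^ 2 / (2 * b * (x - b)) := by
  field_simp
  ring

/-- All branches of the closed form are the generating function of the power sums. -/
lemma closedForm_eq {b x : ℂ} (hb : 2 * b ∉ integers ∨ b ∈ integers)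
    (hx : 2 * (x - b) ∉ integers) : closedForm b x = powerSumGen (shiftInv b) x := by
  have hy : x - b ≠ 0 := fun h => hx (by rw [h]; exact ⟨0, by simp⟩)
  rw [closedForm]
  by_cases h2 : 2 * b ∉ integers
  · rw [if_pos h2]
    have hb0 : b ≠ 0 := by simpa using ne_intCast_of_two_mul_notMem h2 0
    rw [← digammaForm_eq hb hx fun j h => ne_intCast_of_two_mul_notMem h2 (-(j + 1))
      (by push_cast; linear_combination h), digammaForm, ← genericIntegrand_eq h2 hx,
      ← mul_inv_add_inv_eq hb0 hy]
    have s1 := sin_pi_mul_ne_zero_of_notMem h2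
    have s2 := sin_pi_mul_ne_zero_of_notMem hx
    -- Turns `cot π(x-b) + cot πb` into `sin πx / (sin π(x-b) sin πb)`.
    have s3 : sin (π * x) = sin (π * (x - b)) * cos (π * b) + cos (π * (x - b)) * sin (π * b) := by
      rw [← sin_add]; congr 1; ring
    rw [s3, cot, cot]
    generalize sin (π * (x - b)) = p at *
    generalize sin (π * b) = q at *
    field_simp
    ring
  have hbI := hb.resolve_left h2
  rw [if_neg h2]
  by_cases h0 : b = 0
  · subst h0
    have hne : ∀ j : ℕ, (j : ℂ) + 1 + 0 ≠ 0 := fun j => by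
      rw [add_zero]; exact Nat.cast_add_one_ne_zero j
    rw [sub_zero] at hy
    rw [if_pos rfl, ← digammaForm_eq hb hx hne, digammaForm_of_mem hbI hx]
    -- Since `1 / 0 = 0`, only `x · (1/x) / 2` survives.
    have e : x * ((1 / (x - 0) + 1 / 0) / 2) = 1 / 2 := by
      rw [sub_zero, div_zero]; field_simp; ring
    rw [e]
    simp only [integerIntegrand, sub_zero, mul_zero, zero_mul, cos_zero, mul_one]
  rw [if_neg h0]
  by_cases hp : ∃ n : ℕ, 0 < n ∧ b = n
  · rw [if_pos hp]
    obtain ⟨n, -, hbn⟩ := hp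
    have hne : ∀ j : ℕ, (j : ℂ) + 1 + b ≠ 0 := fun j => by
      rw [hbn]; exact_mod_cast Nat.succ_ne_zero (j + n) ∘ fun h => by omega
    rw [← digammaForm_eq hb hx hne, digammaForm_of_mem hbI hx, mul_inv_add_inv_eq h0 hy]
  rw [if_neg hp]
  have hm : ∃ n : ℕ, 0 < n ∧ b = -n := by
    obtain ⟨n, rfl⟩ := hbI
    obtain ⟨m, rfl | rfl⟩ := n.eq_nat_or_neg
    · refine absurd ⟨m, Nat.pos_of_ne_zero ?_, by simp⟩ hp
      rintro rfl; simp at h0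
    · refine ⟨m, Nat.pos_of_ne_zero ?_, by simp⟩
      rintro rfl; simp at h0
  rw [if_pos hm]
  obtain ⟨n, hn, hbn⟩ := hm
  rw [← one_add_digammaForm_eq hn hbn hx, digammaForm_of_mem hbI hx, mul_inv_add_inv_eq h0 hy]
  ring

/-! ### Zeta values as power sums -/

lemma term_succ_eq {k : ℕ} (hk : 2 ≤ k) (b : ℂ) (j : ℕ) : term k (j + 1) b = shiftInv b j ^ k := by
  rw [term, shiftInv]
  push_cast
  split_ifs with h
  · rw [h, inv_zero, zero_pow (by omega)]
  · rw [one_div, inv_pow]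

lemma riemannZeta_eq_tsum_shiftInv {k : ℕ} (hk : 2 ≤ k) :
    riemannZeta (k : ℂ) = ∑' j, shiftInv 0 j ^ k := by
  rw [zeta_nat_eq_tsum_of_gt_one (by omega)]
  have hs : Summable fun n : ℕ => 1 / (n : ℂ) ^ k := by
    rw [← summable_nat_add_iff 1]
    refine (summable_pow_of_sq (summable_shiftInv_sq 0) hk).congr fun j => ?_
    simp [shiftInv]
  rw [hs.tsum_eq_zero_add, Nat.cast_zero, zero_pow (by omega), div_zero, zero_add]
  exact tsum_congr fun j => by simp [shiftInv]

lemma summable_term {k : ℕ} (hk : 2 ≤ k) (b : ℂ) : Summable fun j => term k j b := by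
  rw [← summable_nat_add_iff 1]
  simp only [term_succ_eq hk]
  exact summable_pow_of_sq (summable_shiftInv_sq b) hk

lemma hurwitz_eq_add_tsum {k : ℕ} (hk : 2 ≤ k) {b : ℂ} (hb : b ≠ 0) :
    hurwitz k b = 1 / b ^ k + ∑' j, shiftInv b j ^ k := by
  rw [hurwitz, (summable_term hk b).tsum_eq_zero_add]
  simp only [term_succ_eq hk]
  simp [term, hb]

lemma coeff_eq_tsum {k : ℕ} (hk : 2 ≤ k) (b : ℂ) : coeff k b = ∑' j, shiftInv b j ^ k := by
  rw [coeff]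
  split_ifs with h
  · rw [h, riemannZeta_eq_tsum_shiftInv hk]
  · rw [hurwitz_eq_add_tsum hk h, add_sub_cancel_left]

lemma coeff_natCast {k : ℕ} (hk : 2 ≤ k) (n : ℕ) :
    coeff k n = riemannZeta (k : ℂ) - ∑ j ∈ Finset.Icc 1 n, 1 / (j : ℂ) ^ k := by
  have hs := summable_pow_of_sq (summable_shiftInv_sq 0) hk
  rw [coeff_eq_tsum hk, riemannZeta_eq_tsum_shiftInv hk, ← hs.sum_add_tsum_nat_add n]
  have e1 : ∑ j ∈ Finset.Icc 1 n, 1 / (j : ℂ) ^ k = ∑ j ∈ Finset.range n, shiftInv 0 j ^ k := by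
    rw [← Finset.Ico_add_one_right_eq_Icc, Finset.sum_Ico_eq_sum_range, Nat.add_sub_cancel]
    refine Finset.sum_congr rfl fun j _ => ?_
    rw [shiftInv, add_zero, inv_pow, one_div, Nat.cast_add, Nat.cast_one, add_comm]
  rw [e1, add_sub_cancel_left]
  refine tsum_congr fun j => ?_
  rw [shiftInv, shiftInv]
  push_cast
  ring

lemma norm_mul_inv_lt_one {x a : ℂ} (h : a ≠ 0 → ‖x‖ < ‖a‖) : ‖x * a⁻¹‖ < 1 := by
  rcases eq_or_ne a 0 with rfl | ha
  · simp
  · rw [norm_mul, norm_inv, ← div_eq_mul_inv, div_lt_one (norm_pos_iff.2 ha)]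
    exact h ha

/-! ### Topology of the domain and analytic continuation -/

section Domain

variable {g : ℂ → ℂ}

/-- Every set of integers is closed in `ℂ`, so the value `g a` may be omitted; by injectivity this
restores only the point `a`. -/
lemma isOpen_preimage_integers_compl_union (hg : Continuous g) (hinj : Function.Injective g) (a : ℂ) :
    IsOpen ({x : ℂ | g x ∉ integers} ∪ {a}) := by
  have hc : IsClosed (g ⁻¹' ((fun n : ℤ => (n : ℂ)) '' {n : ℤ | (n : ℂ) ≠ g a})) :=
    (Complex.isClosedEmbedding_intCast.isClosedMap _ (isClosed_discrete _)).preimage hg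
  convert hc.isOpen_compl using 1
  ext x
  by_cases hx : x = a
  · subst hx; simp
  · have : g x ≠ g a := fun h => hx (hinj h)
    simp only [integers, Set.mem_union, Set.mem_ofPred_eq, Set.mem_range, Set.mem_singleton_iff, hx,
      or_false, Set.mem_compl_iff, Set.mem_preimage, Set.mem_image]
    refine not_congr ⟨?_, ?_⟩
    · rintro ⟨n, hn⟩
      exact ⟨n, by rw [hn]; exact this, hn⟩
    · rintro ⟨n, -, hn⟩
      exact ⟨n, hn⟩

lemma isOpen_preimage_integers_compl (hg : Continuous g) : IsOpen {x : ℂ | g x ∉ integers} :=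
  (Complex.isClosedEmbedding_intCast.isClosed_range.preimage hg).isOpen_compl

/-- The complement of a countable set in a real plane is connected. -/
lemma isConnected_of_preimage_integers_compl_subset (hinj : Function.Injective g) {U : Set ℂ}
    (hU : {x : ℂ | g x ∉ integers} ⊆ U) : IsConnected U := by
  have hcount : Uᶜ.Countable := by
    refine ((Set.countable_range fun n : ℤ => (n : ℂ)).preimage hinj).mono fun x hx => ?_
    by_contra h
    exact hx (hU h)
  have := hcount.isConnected_compl_of_one_lt_rank (by simp : 1 < Module.rank ℝ ℂ)
  rwa [compl_compl] at this

end Domain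

lemma genFun_eq_of_mem {b x : ℂ} (hb : 2 * b ∉ integers ∨ b ∈ integers)
    (hx : x ∈ {x : ℂ | 2 * (x - b) ∉ integers} ∪ {0}) :
    genFun b x = powerSumGen (shiftInv b) x := by
  rcases eq_or_ne x 0 with rfl | h0
  · simp [genFun, powerSumGen]
  · rw [genFun, Function.update_of_ne h0]
    exact closedForm_eq hb (hx.resolve_right h0)

lemma two_mul_sub_continuous (b : ℂ) : Continuous fun x : ℂ => 2 * (x - b) := by fun_prop

lemma two_mul_sub_injective (b : ℂ) : Function.Injective fun x : ℂ => 2 * (x - b) := fun x y h => by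
  simpa using h

lemma genFun_eventuallyEq {b x : ℂ} (hb : 2 * b ∉ integers ∨ b ∈ integers)
    (hx : x ∈ {x : ℂ | 2 * (x - b) ∉ integers} ∪ {0}) :
    genFun b =ᶠ[𝓝 x] powerSumGen (shiftInv b) := by
  filter_upwards [(isOpen_preimage_integers_compl_union (two_mul_sub_continuous b)
    (two_mul_sub_injective b) 0).mem_nhds hx] with z hz using genFun_eq_of_mem hb hz

lemma analyticOnNhd_genFun {b : ℂ} (hb : 2 * b ∉ integers ∨ b ∈ integers) :
    AnalyticOnNhd ℂ (genFun b) ({x : ℂ | 2 * (x - b) ∉ integers} ∪ {0}) := by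
  intro x hx
  refine (analyticAt_powerSumGen (summable_shiftInv_sq b) fun j => ?_).congr
    (genFun_eventuallyEq hb hx).symm
  rcases hx with hx | rfl
  · exact ne_one_of_notMem hx j
  · simp

lemma iteratedDeriv_genFun {b : ℂ} (hb : 2 * b ∉ integers ∨ b ∈ integers) {k : ℕ} (hk : 2 ≤ k) :
    iteratedDeriv k (genFun b) 0 / (k.factorial : ℂ) = ∑' j, shiftInv b j ^ k := by
  rw [(genFun_eventuallyEq hb (Or.inr rfl)).iteratedDeriv_eq]
  exact iteratedDeriv_powerSumGen (summable_shiftInv_sq b) hk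

/-! ### The hyperbolic form by rotation -/

section Hyperbolic

/-- The reciprocals `1 / (i (j + 1) + b)`. -/
noncomputable def rotInv (b : ℂ) (j : ℕ) : ℂ := (I * ((j : ℂ) + 1) + b)⁻¹

/-- `i(j+1) + b = i(j + 1 - ib)` and `1/i = -i`. -/
lemma rotInv_eq (b : ℂ) (j : ℕ) : rotInv b j = -I * shiftInv (-I * b) j := by
  rw [rotInv, shiftInv, ← inv_I, ← mul_inv]
  congr 1
  rw [inv_I]
  linear_combination b * I_mul_I

lemma summable_rotInv_sq (b : ℂ) : Summable fun j => ‖rotInv b j‖ ^ 2 := by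
  simpa only [rotInv_eq] using summable_norm_mul_sq (summable_shiftInv_sq (-I * b)) (-I)

lemma powerSumGen_rotInv (b x : ℂ) :
    powerSumGen (rotInv b) x = powerSumGen (shiftInv (-I * b)) (-I * x) := by
  refine tsum_congr fun j => ?_
  rw [rotInv_eq, show x * (-I * shiftInv (-I * b) j) = -I * x * shiftInv (-I * b) j by ring]

lemma neg_mem_integers {a : ℂ} : -a ∈ integers ↔ a ∈ integers := by
  have : ∀ {a : ℂ}, a ∈ integers → -a ∈ integers := by
    rintro _ ⟨n, rfl⟩
    exact ⟨-n, by push_cast; rfl⟩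
  exact ⟨fun h => by simpa using this h, this⟩

lemma rotate_notMem {a : ℂ} (ha : 2 * (I * a) ∉ integers) : 2 * (-I * a) ∉ integers := by
  rwa [show 2 * (-I * a) = -(2 * (I * a)) by ring, neg_mem_integers]

lemma mul_rotInv_ne_one {b x : ℂ} (hx : 2 * (I * (x - b)) ∉ integers) (j : ℕ) :
    x * rotInv b j ≠ 1 := by
  rw [rotInv_eq, ← mul_assoc, mul_comm x]
  exact ne_one_of_notMem (by rw [← mul_sub]; exact rotate_notMem hx) j

lemma sin_neg_I_mul (z : ℂ) : sin (-I * z) = -I * sinh z := by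
  rw [show -I * z = -(z * I) by ring, sin_neg, sin_mul_I]
  ring

lemma hyperbolicIntegrand_eq (b x : ℂ) :
    hyperbolicIntegrand b x = genericIntegrand (-I * b) (-I * x) := by
  funext u
  rw [hyperbolicIntegrand, genericIntegrand]
  rw [show 2 * π * (-I * x - -I * b) * (u : ℂ) = -I * (2 * π * (x - b) * u) by ring,
    show 2 * π * (-I * x - -I * b) = -I * (2 * π * (x - b)) by ring,
    show 2 * π * (-I * b) * (u : ℂ) = -I * (2 * π * b * u) by ring,
    show 2 * π * (-I * b) = -I * (2 * π * b) by ring]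
  simp only [sin_neg_I_mul]
  rw [mul_div_mul_left _ _ (neg_ne_zero.2 I_ne_zero), mul_div_mul_left _ _ (neg_ne_zero.2 I_ne_zero)]
  ring

/-- Each difference of exponentials is a `sinh` at half the argument times exponentials that cancel;
the result matches the rotated cosecant term. -/
lemma exp_ratio_eq {x b : ℂ} (hb : sinh (π * b) ≠ 0) (hy : sinh (π * (x - b)) ≠ 0) :
    (exp (2 * π * x) - 1) / ((exp (-(2 * π * b)) - 1) * (exp (2 * π * x) - exp (2 * π * b)))
      = -(sinh (π * x) / (2 * sinh (π * b) * sinh (π * (x - b)))) := by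
  have hx2 : exp (2 * π * x) - 1 = 2 * exp (π * x) * sinh (π * x) := by
    rw [sinh, show 2 * π * x = π * x + π * x by ring, exp_add, exp_neg]
    field_simp [exp_ne_zero (π * x)]
  have hb2 : exp (-(2 * π * b)) - 1 = -2 * exp (-(π * b)) * sinh (π * b) := by
    rw [sinh, show -(2 * π * b) = -(π * b) + -(π * b) by ring, exp_add, exp_neg]
    field_simp [exp_ne_zero (π * b)]
    ring
  have hxb : exp (2 * π * x) - exp (2 * π * b)
      = 2 * exp (π * x) * exp (π * b) * sinh (π * (x - b)) := by
    rw [sinh, show 2 * π * x = π * x + π * x by ring, show 2 * π * b = π * b + π * b by ring,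
      show π * (x - b) = π * x - π * b by ring, neg_sub, exp_add, exp_add, exp_sub, exp_sub]
    field_simp [exp_ne_zero (π * b), exp_ne_zero (π * x)]
  rw [hx2, hb2, hxb, exp_neg]
  have h1 := exp_ne_zero (π * b)
  have h2 := exp_ne_zero (π * x)
  field_simp

lemma hyperbolicForm_eq {b x : ℂ} (hb : 2 * (I * b) ∉ integers)
    (hx : 2 * (I * (x - b)) ∉ integers) : hyperbolicForm b x = powerSumGen (rotInv b) x := by
  have hb' := rotate_notMem hb
  have hx' : 2 * (-I * x - -I * b) ∉ integers := by
    rw [← mul_sub]; exact rotate_notMem hx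
  rw [powerSumGen_rotInv, ← closedForm_eq (Or.inl hb') hx', closedForm, if_pos hb',
    hyperbolicForm, hyperbolicIntegrand_eq]
  have s1 := sin_pi_mul_ne_zero_of_notMem hb'
  have s2 := sin_pi_mul_ne_zero_of_notMem hx'
  have e1 : π * (-I * b) = -I * (π * b) := by ring
  have e2 : π * (-I * x - -I * b) = -I * (π * (x - b)) := by ring
  have e3 : π * (-I * x) = -I * (π * x) := by ring
  rw [e1, sin_neg_I_mul] at s1
  rw [e2, sin_neg_I_mul] at s2
  rw [e1, e2, e3, sin_neg_I_mul, sin_neg_I_mul, sin_neg_I_mul, mul_div_assoc,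
    exp_ratio_eq (right_ne_zero_of_mul s1) (right_ne_zero_of_mul s2)]
  have q : (-I * x) ^ 2 / (2 * (-I * b) * (-I * x - -I * b)) = x ^ 2 / (2 * b * (x - b)) := by
    rw [show (-I * x) ^ 2 = (-I) ^ 2 * x ^ 2 by ring,
      show 2 * (-I * b) * (-I * x - -I * b) = (-I) ^ 2 * (2 * b * (x - b)) by ring,
      mul_div_mul_left _ _ (pow_ne_zero 2 (neg_ne_zero.2 I_ne_zero))]
  rw [q]
  have h1 := right_ne_zero_of_mul s1
  have h2 := right_ne_zero_of_mul s2
  have hI := I_ne_zero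
  generalize sinh (π * b) = p at *
  generalize sinh (π * (x - b)) = r at *
  field_simp
  ring

end Hyperbolic

end HurwitzGen

theorem mainTheorem2 :
    -- trigonometric form, for `2b` not an integer or `b` an integer
    (∀ b : ℂ, (2 * b ∉ HurwitzGen.integers ∨ b ∈ HurwitzGen.integers) →
      -- the coefficients are the convergent sums over `j ≥ 1`
      (∀ k : ℕ, 2 ≤ k →
        HasSum (fun j : ℕ => HurwitzGen.term k (j + 1) b) (HurwitzGen.coeff k b)) ∧
      (∀ n : ℕ, 0 < n → b = n → ∀ k : ℕ, 2 ≤ k →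
        HurwitzGen.coeff k b
          = riemannZeta (k : ℂ) - ∑ j ∈ Finset.Icc 1 n, 1 / (j : ℂ) ^ k) ∧
      -- the explicit form of the series
      (∀ x : ℂ, 2 * (x - b) ∉ HurwitzGen.integers →
        (2 * b ∉ HurwitzGen.integers →
          IntervalIntegrable (HurwitzGen.genericIntegrand b x) MeasureTheory.volume 0 1) ∧
        (b ∈ HurwitzGen.integers →
          IntervalIntegrable (HurwitzGen.integerIntegrand b x) MeasureTheory.volume 0 1) ∧
        ((∀ j : ℕ, 1 ≤ j → (j : ℂ) + b ≠ 0 → ‖x‖ < ‖(j : ℂ) + b‖) →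
          HasSum (fun k : ℕ => x ^ (k + 2) * HurwitzGen.coeff (k + 2) b)
            (HurwitzGen.closedForm b x)) ∧
        (∀ s : ℂ,
          Tendsto (fun N : ℕ => ∑ k ∈ Finset.Icc 2 N, x ^ k * HurwitzGen.coeff k b)
            atTop (𝓝 s) →
          s = HurwitzGen.closedForm b x)) ∧
      -- analytic continuation, with the removable singularity at `0` filled in
      IsOpen ({x : ℂ | 2 * (x - b) ∉ HurwitzGen.integers} ∪ {0}) ∧
      IsConnected ({x : ℂ | 2 * (x - b) ∉ HurwitzGen.integers} ∪ {0}) ∧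
      AnalyticOnNhd ℂ (HurwitzGen.genFun b)
        ({x : ℂ | 2 * (x - b) ∉ HurwitzGen.integers} ∪ {0}) ∧
      -- recovery of the zeta values
      (∀ k : ℕ, 2 ≤ k →
        (b ≠ 0 → HurwitzGen.hurwitz k b
          = 1 / b ^ k + iteratedDeriv k (HurwitzGen.genFun b) 0 / (k.factorial : ℂ)) ∧
        (b = 0 → riemannZeta (k : ℂ)
          = iteratedDeriv k (HurwitzGen.genFun b) 0 / (k.factorial : ℂ)))) ∧
    -- hyperbolic form, for the sums of `1 / (i j + b)^k`
    (∀ b : ℂ, 2 * (Complex.I * b) ∉ HurwitzGen.integers →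
      (∀ k : ℕ, 2 ≤ k →
        Summable (fun j : ℕ => 1 / (Complex.I * ((j : ℂ) + 1) + b) ^ k)) ∧
      (∀ x : ℂ, 2 * (Complex.I * (x - b)) ∉ HurwitzGen.integers →
        IntervalIntegrable (HurwitzGen.hyperbolicIntegrand b x) MeasureTheory.volume 0 1 ∧
        ((∀ j : ℕ, 1 ≤ j → ‖x‖ < ‖Complex.I * (j : ℂ) + b‖) →
          HasSum (fun k : ℕ => x ^ (k + 2) * HurwitzGen.rotatedCoeff (k + 2) b)
            (HurwitzGen.hyperbolicForm b x)) ∧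
        (∀ s : ℂ,
          Tendsto (fun N : ℕ => ∑ k ∈ Finset.Icc 2 N, x ^ k * HurwitzGen.rotatedCoeff k b)
            atTop (𝓝 s) →
          s = HurwitzGen.hyperbolicForm b x)) ∧
      IsOpen {x : ℂ | 2 * (Complex.I * (x - b)) ∉ HurwitzGen.integers} ∧
      IsConnected {x : ℂ | 2 * (Complex.I * (x - b)) ∉ HurwitzGen.integers} ∧
      AnalyticOnNhd ℂ (HurwitzGen.hyperbolicForm b)
        {x : ℂ | 2 * (Complex.I * (x - b)) ∉ HurwitzGen.integers}) := by
  refine ⟨fun b hb => ?_, fun b hb => ?_⟩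
  · have hsq := HurwitzGen.summable_shiftInv_sq b
    have hcont := HurwitzGen.two_mul_sub_continuous b
    have hinj := HurwitzGen.two_mul_sub_injective b
    refine ⟨fun k hk => ?_, ?_, fun x hx => ⟨?_, ?_, ?_, ?_⟩,
      HurwitzGen.isOpen_preimage_integers_compl_union hcont hinj 0,
      HurwitzGen.isConnected_of_preimage_integers_compl_subset hinj Set.subset_union_left,
      HurwitzGen.analyticOnNhd_genFun hb, fun k hk => ⟨fun h0 => ?_, ?_⟩⟩
    · simp only [HurwitzGen.term_succ_eq hk, HurwitzGen.coeff_eq_tsum hk]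
      exact (HurwitzGen.summable_pow_of_sq hsq hk).hasSum
    · rintro n - rfl k hk
      exact HurwitzGen.coeff_natCast hk n
    · intro h2
      rw [HurwitzGen.genericIntegrand_eq h2 hx]
      exact HurwitzGen.intervalIntegrable_sineRatio_mul_cot hb hx
    · intro h2
      rw [HurwitzGen.integerIntegrand_eq h2 hx]
      exact HurwitzGen.intervalIntegrable_sineRatio_mul_cot hb hx
    · intro hlt
      simp only [HurwitzGen.coeff_eq_tsum (Nat.le_add_left 2 _), HurwitzGen.closedForm_eq hb hx]
      refine HurwitzGen.hasSum_powerSumGen hsq fun j => HurwitzGen.norm_mul_inv_lt_one fun hj => ?_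
      have := hlt (j + 1) (Nat.le_add_left 1 j)
      push_cast at this
      exact this hj
    · intro s hs
      rw [HurwitzGen.closedForm_eq hb hx]
      refine HurwitzGen.eq_powerSumGen_of_tendsto hsq (HurwitzGen.ne_one_of_notMem hx)
        (hs.congr fun N => Finset.sum_congr rfl fun k hk => ?_)
      rw [HurwitzGen.coeff_eq_tsum (Finset.mem_Icc.1 hk).1]
    · rw [HurwitzGen.iteratedDeriv_genFun hb hk, HurwitzGen.hurwitz_eq_add_tsum hk h0]
    · rintro rfl
      rw [HurwitzGen.iteratedDeriv_genFun hb hk, HurwitzGen.riemannZeta_eq_tsum_shiftInv hk]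
  · have hsq := HurwitzGen.summable_rotInv_sq b
    have hcont : Continuous fun x : ℂ => 2 * (Complex.I * (x - b)) := by fun_prop
    have hinj : Function.Injective fun x : ℂ => 2 * (Complex.I * (x - b)) := fun x y h => by
      simpa using h
    have hcoeff : ∀ k, HurwitzGen.rotatedCoeff k b = ∑' j, HurwitzGen.rotInv b j ^ k := fun k =>
      tsum_congr fun j => by rw [HurwitzGen.rotInv, one_div, inv_pow]
    have hopen := HurwitzGen.isOpen_preimage_integers_compl hcont
    refine ⟨fun k hk => ?_, fun x hx => ⟨?_, ?_, ?_⟩, hopen,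
      HurwitzGen.isConnected_of_preimage_integers_compl_subset hinj subset_rfl, fun x hx => ?_⟩
    · simpa only [HurwitzGen.rotInv, one_div, inv_pow] using HurwitzGen.summable_pow_of_sq hsq hk
    · have hx' : 2 * (-Complex.I * x - -Complex.I * b) ∉ HurwitzGen.integers := by
        rw [← mul_sub]; exact HurwitzGen.rotate_notMem hx
      have hb' := HurwitzGen.rotate_notMem hb
      rw [HurwitzGen.hyperbolicIntegrand_eq, HurwitzGen.genericIntegrand_eq hb' hx']
      exact HurwitzGen.intervalIntegrable_sineRatio_mul_cot (Or.inl hb') hx'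
    · intro hlt
      simp only [hcoeff, HurwitzGen.hyperbolicForm_eq hb hx]
      refine HurwitzGen.hasSum_powerSumGen hsq fun j => HurwitzGen.norm_mul_inv_lt_one fun _ => ?_
      have := hlt (j + 1) (Nat.le_add_left 1 j)
      push_cast at this
      exact this
    · intro s hs
      simp only [hcoeff] at hs
      rw [HurwitzGen.hyperbolicForm_eq hb hx]
      exact HurwitzGen.eq_powerSumGen_of_tendsto hsq (HurwitzGen.mul_rotInv_ne_one hx) hs
    · refine (HurwitzGen.analyticAt_powerSumGen hsq (HurwitzGen.mul_rotInv_ne_one hx)).congr ?_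
      filter_upwards [hopen.mem_nhds hx] with z hz
      exact (HurwitzGen.hyperbolicForm_eq hb hz).symm
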